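/- Let $E$ be an elliptic curve over $\mathbb{R}$, given by a Weierstrass equation $$Y^2 + a_1XY + a_3Y = X^3 + a_2X^2 + a_4X + a_6, \qquad a_i \in \mathbb{R},$$ with discriminant $\Delta_E \neq 0$. Let $E(\mathbb{R})$ be its group of real points, that is, the points $[x,y,1]$ with $(x,y)\in\mathbb{R}^2$ a solution of the equation, together with the point at infinity $O=[0,1,0]$ as identity element, with the usual group law and with the topology of a subspace of the real projective plane $\mathbb{P}^2(\mathbb{R})$ (this is the topology of the Lie group $E(\mathbb{R})$). A function $f : G \to G$ on a group $G$ is called inverse ambiguous if it is bijective and $f^{-1}(x) = (f(x))^{-1}$ for all $x \in G$, where $f^{-1}$ is the inverse function of $f$ and $(f(x))^{-1}$ is the inverse of $f(x)$ in $G$. Then $E(\mathbb{R})$ admits a continuous inverse ambiguous function if and only if $\Delta_E > 0$. -/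

import Mathlib

open scoped LinearAlgebra.Projectivization

/-- A bijection `f` of a group `G` (written additively) is inverse ambiguous if the inverse function
of `f` is the pointwise group inverse of `f`, that is, `f⁻¹(x) = -(f x)` for all `x`. -/
def IsInverseAmbiguous {G : Type*} [AddGroup G] (f : G ≃ G) : Prop :=
  ∀ x : G, f.symm x = -(f x)

/-- The real projective plane. -/
abbrev RealProjectivePlane : Type := ℙ ℝ (Fin 3 → ℝ)

/-- The quotient topology on the real projective plane, as a quotient of `ℝ³ \ {0}`. -/
noncomputable instance RealProjectivePlane.instTopologicalSpace : TopologicalSpace RealProjectivePlane :=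
  TopologicalSpace.coinduced
    (fun v : {v : Fin 3 → ℝ // v ≠ 0} => (Projectivization.mk ℝ v.1 v.2 : RealProjectivePlane))
    inferInstance

/-- The inclusion of the real points of a Weierstrass curve in the real projective plane: an affine
point `(x, y)` is sent to `[x, y, 1]`, and the point at infinity to `[0, 1, 0]`. -/
noncomputable def realPointToPlane (E : WeierstrassCurve ℝ) : E.toAffine.Point → RealProjectivePlane
  | .zero => Projectivization.mk ℝ ![0, 1, 0] (fun h => one_ne_zero (congrFun h 1))
  | .some x y _ => Projectivization.mk ℝ ![x, y, 1] (fun h => one_ne_zero (congrFun h 2))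

/-- The topology on the group of real points, as a subspace of the real projective plane. -/
noncomputable instance realPointTopology (E : WeierstrassCurve ℝ) : TopologicalSpace E.toAffine.Point :=
  TopologicalSpace.induced (realPointToPlane E) inferInstance

/-!
A bijection `f` is inverse ambiguous exactly when `f ∘ f` is negation on the group. Negation sends a
point `(x, y)` to `(x, y')` with the opposite value of `η = 2y + a₁x + a₃`, and in terms of `η` the
curve reads `η² = ψ(x)` with `ψ = 4x³ + b₂x² + 2b₄x + b₆`, a cubic of discriminant `16Δ`.

If `Δ < 0`, then `ψ` has exactly one real root `e`, and the points which are not fixed by negation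
form two halves `η > 0` and `η < 0`, open, interchanged by negation, and connected, since each is a
graph over `(e, ∞)`. A continuous square root `f` of negation commutes with negation, hence maps the
upper half into one of the two halves; in either case `f ∘ f` maps the upper half into itself, so it
is not negation (`WeierstrassCurve.not_exists_sqrt_neg`).

If `Δ > 0`, then `ψ = 4u(u - p)(u - q)` with `u = x - e`, where `e` is the smallest root and
`0 < p < q`. The map `(u, η) ↦ (pq/u, pqη/u²)` (up to sign, the translation by the point of order two
`(e, 0)`) is an involution that commutes with negation and interchanges the two components
`0 ≤ u ≤ p` and `q ≤ u ≤ ∞` of the curve. Composing it with negation on the bounded component only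
gives a continuous square root of negation (`WeierstrassCurve.exists_sqrt_neg`). Continuity is
checked on charts of the projective plane, on each of which the map is given by quadratic forms.
-/

open Filter Topology

namespace WeierstrassCurve

variable {E : WeierstrassCurve ℝ}

/-! ### The topology of the group of real points -/

/-- Homogeneous coordinates of a real point: `(x, y, 1)` for an affine point, and `(0, 1, 0)` for the
point at infinity. -/
def homCoords : E.toAffine.Point → Fin 3 → ℝ
  | .zero => ![0, 1, 0]
  | .some x y _ => ![x, y, 1]

lemma homCoords_ne_zero (P : E.toAffine.Point) : homCoords P ≠ 0 := by
  cases P with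
  | zero => exact fun h => one_ne_zero (congrFun h 1)
  | some x y _ => exact fun h => one_ne_zero (congrFun h 2)

lemma realPointToPlane_eq (P : E.toAffine.Point) :
    realPointToPlane E P = Projectivization.mk ℝ (homCoords P) (homCoords_ne_zero P) := by
  cases P <;> rfl

/-- An open cone in `ℝ³` defines an open condition on real points. -/
lemma eventually_homCoords_mem {s : Set (Fin 3 → ℝ)} (hs : IsOpen s)
    (hom : ∀ c : ℝ, c ≠ 0 → ∀ v ∈ s, c • v ∈ s) {P : E.toAffine.Point} (hP : homCoords P ∈ s) :
    ∀ᶠ Q in 𝓝 P, homCoords Q ∈ s := by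
  let U : Set RealProjectivePlane := {x | x.rep ∈ s}
  have hmem : ∀ (v : Fin 3 → ℝ) (hv : v ≠ 0),
      (Projectivization.mk ℝ v hv : RealProjectivePlane) ∈ U ↔ v ∈ s := by
    intro v hv
    obtain ⟨a, ha⟩ := Projectivization.exists_smul_eq_mk_rep ℝ v hv
    change (Projectivization.mk ℝ v hv).rep ∈ s ↔ v ∈ s
    rw [← ha]
    refine ⟨fun h => ?_, fun h => hom a a.ne_zero v h⟩
    simpa [Units.smul_def, smul_smul] using hom _ (inv_ne_zero a.ne_zero) _ h
  have hU : IsOpen U := by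
    refine isOpen_coinduced.mpr ?_
    convert hs.preimage continuous_subtype_val using 1
    ext v
    exact hmem v.1 v.2
  have hι : Continuous (realPointToPlane E) := continuous_induced_dom
  have hPU : realPointToPlane E P ∈ U := by rwa [realPointToPlane_eq, hmem]
  filter_upwards [hι.continuousAt (hU.mem_nhds hPU)] with Q hQ
  have hQ' : realPointToPlane E Q ∈ U := hQ
  rwa [realPointToPlane_eq, hmem] at hQ'

/-- The sign of a quadratic form is constant near a real point where it does not vanish. -/
lemma eventually_pos {r : (Fin 3 → ℝ) → ℝ} (hr : Continuous r)
    (hom : ∀ (c : ℝ) v, r (c • v) = c ^ 2 * r v) {P : E.toAffine.Point}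
    (hP : 0 < r (homCoords P)) : ∀ᶠ Q in 𝓝 P, 0 < r (homCoords Q) := by
  refine eventually_homCoords_mem (s := {v | 0 < r v}) (isOpen_lt continuous_const hr) ?_ hP
  intro c hc v hv
  have hv' : 0 < r v := hv
  simp only [Set.mem_ofPred_eq, hom]
  positivity

lemma isOpen_setOf_pos {r : (Fin 3 → ℝ) → ℝ} (hr : Continuous r)
    (hom : ∀ (c : ℝ) v, r (c • v) = c ^ 2 * r v) :
    IsOpen {P : E.toAffine.Point | 0 < r (homCoords P)} :=
  isOpen_iff_eventually.mpr fun _ hP => eventually_pos hr hom hP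

/-- A map of real points which is given by quadratic forms near `P`, not all of which vanish at `P`,
is continuous at `P`. -/
lemma continuousAt_of_homogeneous {f : E.toAffine.Point → E.toAffine.Point}
    {F : (Fin 3 → ℝ) → (Fin 3 → ℝ)} (hF : Continuous F)
    (hom : ∀ (c : ℝ) v, F (c • v) = c ^ 2 • F v) {P : E.toAffine.Point}
    (hP : F (homCoords P) ≠ 0)
    (hf : ∀ᶠ Q in 𝓝 P, ∃ c : ℝ, F (homCoords Q) = c • homCoords (f Q)) : ContinuousAt f P := by
  have key : ∀ Q, (∃ c : ℝ, F (homCoords Q) = c • homCoords (f Q)) →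
      ∀ h : F (homCoords Q) ≠ 0,
        realPointToPlane E (f Q) = Projectivization.mk ℝ (F (homCoords Q)) h := by
    rintro Q ⟨c, hc⟩ h
    rw [realPointToPlane_eq, eq_comm, Projectivization.mk_eq_mk_iff']
    exact ⟨c, hc.symm⟩
  have hind : IsInducing (realPointToPlane E) := ⟨rfl⟩
  rw [hind.continuousAt_iff]
  intro W hW
  obtain ⟨W', hW'W, hW', hPW'⟩ := mem_nhds_iff.mp hW
  let t : Set (Fin 3 → ℝ) :=
    {w | ∃ h : w ≠ 0, (Projectivization.mk ℝ w h : RealProjectivePlane) ∈ W'}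
  have ht : IsOpen t := by
    have h1 := isOpen_coinduced.mp hW'
    have h2 := (isOpen_compl_singleton (x := (0 : Fin 3 → ℝ))).isOpenMap_subtype_val _ h1
    convert h2 using 1
    ext w
    constructor
    · rintro ⟨h, hw⟩
      exact ⟨⟨w, h⟩, hw, rfl⟩
    · rintro ⟨⟨w, h⟩, hw, rfl⟩
      exact ⟨h, hw⟩
  have hs : ∀ c : ℝ, c ≠ 0 → ∀ v ∈ F ⁻¹' t, c • v ∈ F ⁻¹' t := by
    rintro c hc v ⟨h, hv⟩
    have hne : F (c • v) ≠ 0 := by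
      rw [hom]
      exact smul_ne_zero (pow_ne_zero 2 hc) h
    refine ⟨hne, ?_⟩
    convert hv using 1
    rw [Projectivization.mk_eq_mk_iff']
    exact ⟨c ^ 2, (hom c v).symm⟩
  have hPt : homCoords P ∈ F ⁻¹' t := by
    refine ⟨hP, ?_⟩
    rw [← key P hf.self_of_nhds hP]
    exact hPW'
  have hev := eventually_homCoords_mem (ht.preimage hF) hs hPt
  show ∀ᶠ Q in 𝓝 P, realPointToPlane E (f Q) ∈ W
  filter_upwards [hf, hev] with Q hQ hQt
  obtain ⟨h, hQW⟩ := hQt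
  rw [key Q hQ h]
  exact hW'W hQW

/-! ### Coordinates adapted to negation -/

lemma Affine.Point.some_eq_some {x y x' y' : ℝ} {h : E.toAffine.Nonsingular x y}
    {h' : E.toAffine.Nonsingular x' y'} (hx : x = x') (hy : y = y') :
    Affine.Point.some x y h = Affine.Point.some x' y' h' := by
  subst hx hy
  rfl

variable (E) in
/-- The linear form `2y + a₁x + a₃z`; on affine points, its zeros are the points of order two. -/
def etaForm (v : Fin 3 → ℝ) : ℝ := 2 * v 1 + E.a₁ * v 0 + E.a₃ * v 2

variable (E) in
lemma continuous_etaForm : Continuous E.etaForm := by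
  unfold etaForm
  fun_prop

lemma etaForm_smul (c : ℝ) (v : Fin 3 → ℝ) : E.etaForm (c • v) = c * E.etaForm v := by
  simp only [etaForm, Pi.smul_apply, smul_eq_mul]
  ring

lemma eta_sq {x y : ℝ} (h : E.toAffine.Nonsingular x y) :
    (2 * y + E.a₁ * x + E.a₃) ^ 2 = 4 * x ^ 3 + E.b₂ * x ^ 2 + 2 * E.b₄ * x + E.b₆ := by
  have h1 := (Affine.equation_iff _ _).mp h.1
  simp only [b₂, b₄, b₆]
  linear_combination 4 * h1

variable (E) in
/-- The real cubic `4x³ + b₂x² + 2b₄x + b₆` has a root; the discriminant of the curve is expressed by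
the coefficients of the cofactor. -/
lemma exists_root : ∃ e a b : ℝ,
    (∀ x, 4 * x ^ 3 + E.b₂ * x ^ 2 + 2 * E.b₄ * x + E.b₆ =
      4 * (x - e) * ((x - e) ^ 2 + a * (x - e) + b)) ∧ E.Δ = 16 * (a ^ 2 - 4 * b) * b ^ 2 := by
  obtain ⟨e, he⟩ : ∃ e : ℝ, 4 * e ^ 3 + E.b₂ * e ^ 2 + 2 * E.b₄ * e + E.b₆ = 0 := by
    have hc : Continuous fun e : ℝ => 4 * e ^ 3 + E.b₂ * e ^ 2 + 2 * E.b₄ * e + E.b₆ := by fun_prop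
    -- The cubic is nonpositive at `-M` and nonnegative at `M`: the leading term dominates there.
    set M := 1 + |E.b₂| + |2 * E.b₄| + |E.b₆| with hM
    have h2 := abs_nonneg E.b₂
    have h4 := abs_nonneg (2 * E.b₄)
    have h6 := abs_nonneg E.b₆
    have hM1 : 1 ≤ M := by linarith
    have hMM : M ≤ M ^ 2 := by nlinarith
    have p2 : |E.b₂| * M ^ 2 ≤ M ^ 2 * (M - 1 - |2 * E.b₄| - |E.b₆|) := by
      rw [hM]
      apply le_of_eq
      ring
    have p4 : |2 * E.b₄| * M ≤ |2 * E.b₄| * M ^ 2 := mul_le_mul_of_nonneg_left hMM h4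
    have p6 : |E.b₆| ≤ |E.b₆| * M ^ 2 := le_mul_of_one_le_right h6 (by linarith)
    have q2 := abs_le.mp (le_of_eq (show |E.b₂ * M ^ 2| = |E.b₂| * M ^ 2 by
      rw [abs_mul, abs_of_nonneg (sq_nonneg M)]))
    have q4 := abs_le.mp (le_of_eq (show |2 * E.b₄ * M| = |2 * E.b₄| * M by
      rw [abs_mul, abs_of_nonneg (show 0 ≤ M by linarith)]))
    have q6 := abs_le.mp (le_refl |E.b₆|)
    have hM3 : 0 ≤ M ^ 3 := by positivity
    obtain ⟨e, -, he⟩ := intermediate_value_Icc (show -M ≤ M by linarith) hc.continuousOn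
      (show (0 : ℝ) ∈ Set.Icc _ _ from ⟨by nlinarith, by nlinarith⟩)
    exact ⟨e, he⟩
  refine ⟨e, 3 * e + E.b₂ / 4, 3 * e ^ 2 + E.b₂ * e / 2 + E.b₄ / 2, fun x => ?_, ?_⟩
  · linear_combination he
  · have h6 : E.b₆ = -(4 * e ^ 3 + E.b₂ * e ^ 2 + 2 * E.b₄ * e) := by linarith
    have h8 : E.b₈ = (E.b₂ * E.b₆ - E.b₄ ^ 2) / 4 := by linarith [E.b_relation]
    rw [Δ, h8, h6]
    ring

lemma homCoords_zero : homCoords (0 : E.toAffine.Point) = ![0, 1, 0] := rfl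

variable [E.IsElliptic]

lemma nonsingular_of_eta {x η : ℝ}
    (h : η ^ 2 = 4 * x ^ 3 + E.b₂ * x ^ 2 + 2 * E.b₄ * x + E.b₆) :
    E.toAffine.Nonsingular x ((η - E.a₁ * x - E.a₃) / 2) := by
  rw [← Affine.equation_iff_nonsingular, Affine.equation_iff]
  simp only [b₂, b₄, b₆] at h
  linear_combination h / 4

/-- The affine point with given `x`-coordinate and given value `η` of `2y + a₁x + a₃`. -/
noncomputable def pointOfEta (x η : ℝ)
    (h : η ^ 2 = 4 * x ^ 3 + E.b₂ * x ^ 2 + 2 * E.b₄ * x + E.b₆) : E.toAffine.Point :=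
  .some x ((η - E.a₁ * x - E.a₃) / 2) (nonsingular_of_eta h)

lemma exists_eq_pointOfEta (P : E.toAffine.Point) : P = 0 ∨ ∃ x η h, P = pointOfEta x η h := by
  cases P with
  | zero => exact .inl rfl
  | some x y h =>
    exact .inr ⟨x, _, eta_sq h, Affine.Point.some_eq_some rfl (by ring)⟩

lemma pointOfEta_congr {x η x' η' : ℝ} {h h'} (hx : x = x') (hη : η = η') :
    (pointOfEta x η h : E.toAffine.Point) = pointOfEta x' η' h' := by
  subst hx hη
  rfl

lemma neg_pointOfEta {x η : ℝ} {h} :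
    -(pointOfEta x η h : E.toAffine.Point) = pointOfEta x (-η) (by rw [neg_sq, h]) := by
  unfold pointOfEta
  rw [Affine.Point.neg_some]
  refine Affine.Point.some_eq_some rfl ?_
  simp only [Affine.negY]
  ring

lemma homCoords_pointOfEta {x η : ℝ} {h} :
    homCoords (pointOfEta x η h : E.toAffine.Point) = ![x, (η - E.a₁ * x - E.a₃) / 2, 1] := rfl

lemma etaForm_pointOfEta {x η : ℝ} {h} :
    E.etaForm (homCoords (pointOfEta x η h : E.toAffine.Point)) = η := by
  simp [homCoords_pointOfEta, etaForm]
  ring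

/-! ### Negative discriminant -/

/-- If the discriminant is negative, the half `η > 0` of the real points is connected. -/
lemma isPreconnected_etaForm_pos (hΔ : E.Δ < 0) :
    IsPreconnected {P : E.toAffine.Point |
      0 < E.etaForm (homCoords P) * homCoords P 2} ∧
    ∃ P : E.toAffine.Point, 0 < E.etaForm (homCoords P) * homCoords P 2 := by
  obtain ⟨e, a, b, hψ, hD⟩ := E.exists_root
  have hq : ∀ u : ℝ, 0 < u ^ 2 + a * u + b := by
    intro u
    have : a ^ 2 - 4 * b < 0 := by
      by_contra! h
      have := mul_nonneg h (sq_nonneg b)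
      linarith
    nlinarith [sq_nonneg (2 * u + a)]
  have hpos : ∀ x : ℝ, 0 < 4 * x ^ 3 + E.b₂ * x ^ 2 + 2 * E.b₄ * x + E.b₆ ↔ e < x := by
    intro x
    rw [hψ, mul_pos_iff_of_pos_right (hq _)]
    constructor <;> intro h <;> linarith
  let g : Set.Ioi e → E.toAffine.Point := fun x =>
    pointOfEta x.1 (√(4 * x.1 ^ 3 + E.b₂ * x.1 ^ 2 + 2 * E.b₄ * x.1 + E.b₆))
      (Real.sq_sqrt ((hpos _).mpr x.2).le)
  have hg : Continuous g := by
    refine continuous_induced_rng.mpr ?_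
    let k : Set.Ioi e → {v : Fin 3 → ℝ // v ≠ 0} := fun x =>
      ⟨homCoords (g x), homCoords_ne_zero _⟩
    have hk : Continuous k := by
      refine Continuous.subtype_mk ?_ _
      simp only [g, homCoords_pointOfEta]
      refine continuous_pi fun i => ?_
      fin_cases i
      · simpa using continuous_subtype_val
      · simp only [Fin.mk_one, Matrix.cons_val_one, Matrix.cons_val_zero]
        fun_prop
      · simpa using continuous_const
    have hmk : Continuous fun v : {v : Fin 3 → ℝ // v ≠ 0} =>
        (Projectivization.mk ℝ v.1 v.2 : RealProjectivePlane) := continuous_coinduced_rng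
    exact hmk.comp hk
  have himg : {P : E.toAffine.Point | 0 < E.etaForm (homCoords P) * homCoords P 2} =
      Set.range g := by
    ext P
    simp only [Set.mem_ofPred_eq, Set.mem_range]
    constructor
    · intro hP
      rcases exists_eq_pointOfEta P with rfl | ⟨x, η, h, rfl⟩
      · simp [homCoords_zero] at hP
      · have hη : 0 < η := by
          rw [etaForm_pointOfEta] at hP
          simpa [homCoords_pointOfEta] using hP
        refine ⟨⟨x, (hpos x).mp (h ▸ by positivity)⟩, pointOfEta_congr rfl ?_⟩
        simp only [← h]
        exact Real.sqrt_sq hη.le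
    · rintro ⟨x, rfl⟩
      simp only [g, etaForm_pointOfEta]
      simpa [homCoords_pointOfEta] using (hpos _).mpr x.2
  rw [himg]
  have : PreconnectedSpace (Set.Ioi e) := isPreconnected_iff_preconnectedSpace.mp isPreconnected_Ioi
  refine ⟨isPreconnected_range hg, g ⟨e + 1, by simp⟩, ?_⟩
  have : g ⟨e + 1, by simp⟩ ∈ Set.range g := ⟨_, rfl⟩
  rwa [← himg] at this

lemma etaForm_neg (P : E.toAffine.Point) :
    E.etaForm (homCoords (-P)) * homCoords (-P) 2 =
      -(E.etaForm (homCoords P) * homCoords P 2) := by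
  rcases exists_eq_pointOfEta P with rfl | ⟨x, η, h, rfl⟩
  · simp [homCoords_zero]
  · rw [neg_pointOfEta, etaForm_pointOfEta, etaForm_pointOfEta]
    simp [homCoords_pointOfEta]

lemma neg_eq_self_of_etaForm_eq_zero {P : E.toAffine.Point}
    (hP : E.etaForm (homCoords P) * homCoords P 2 = 0) : -P = P := by
  rcases exists_eq_pointOfEta P with rfl | ⟨x, η, h, rfl⟩
  · exact neg_zero
  · have hη : η = 0 := by
      rw [etaForm_pointOfEta] at hP
      simpa [homCoords_pointOfEta] using hP
    rw [neg_pointOfEta]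
    exact pointOfEta_congr rfl (by simp [hη])

/-- A continuous `f` with `f ∘ f` equal to negation permutes the points that are not fixed by negation,
so by connectedness it maps the half `η > 0` into one of the two halves. Either case forces `f ∘ f` to
preserve the half `η > 0`. -/
lemma not_exists_sqrt_neg (hΔ : E.Δ < 0) {f : E.toAffine.Point → E.toAffine.Point}
    (hf : Continuous f) (hff : ∀ P, f (f P) = -P) : False := by
  -- `r` is `η` on affine points and `0` at infinity, so its zeros are the fixed points of negation.
  set r : E.toAffine.Point → ℝ := fun P => E.etaForm (homCoords P) * homCoords P 2
  have hrneg : ∀ P, r (-P) = -r P := etaForm_neg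
  have hfneg : ∀ P, f (-P) = -f P := fun P => by rw [← hff P, hff]
  have hfr : ∀ P, r P ≠ 0 → r (f P) ≠ 0 := by
    intro P hP h0
    have h1 : f (-P) = f P := by rw [hfneg, neg_eq_self_of_etaForm_eq_zero h0]
    have h2 : -P = P := by
      have h3 := congrArg f h1
      rw [hff, hff] at h3
      exact neg_injective h3
    have h3 := hrneg P
    rw [h2] at h3
    exact hP (by linarith)
  have hc : Continuous fun v : Fin 3 → ℝ => E.etaForm v * v 2 :=
    E.continuous_etaForm.mul (continuous_apply 2)
  have hU : IsOpen {P | 0 < r P} := isOpen_setOf_pos hc fun c v => by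
    rw [etaForm_smul, Pi.smul_apply, smul_eq_mul]
    ring
  have hV : IsOpen {P | 0 < -r P} := isOpen_setOf_pos hc.neg fun c v => by
    simp only [Pi.neg_apply]
    rw [etaForm_smul, Pi.smul_apply, smul_eq_mul]
    ring
  obtain ⟨hA, P, hP⟩ := isPreconnected_etaForm_pos hΔ
  replace hP : 0 < r P := hP
  have hfA : IsPreconnected (f '' {P | 0 < r P}) := hA.image f hf.continuousOn
  have hcover : f '' {P | 0 < r P} ⊆ {P | 0 < r P} ∪ {P | 0 < -r P} := by
    rintro _ ⟨Q, hQ, rfl⟩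
    have hQ' : 0 < r Q := hQ
    rcases lt_or_gt_of_ne (hfr Q hQ'.ne') with h | h
    · exact .inr (neg_pos.mpr h)
    · exact .inl h
  have hdisj : Disjoint {P | 0 < r P} {P | 0 < -r P} := by
    rw [Set.disjoint_left]
    intro Q h1 h2
    have h1' : 0 < r Q := h1
    have h2' : 0 < -r Q := h2
    linarith
  have hffP : r (f (f P)) < 0 := by
    rw [hff, hrneg]
    linarith
  rcases hfA.subset_or_subset hU hV hdisj hcover with h | h
  · have h1 : 0 < r (f P) := h ⟨P, hP, rfl⟩
    have h2 : 0 < r (f (f P)) := h ⟨f P, h1, rfl⟩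
    linarith
  · have h1 : 0 < -r (f P) := h ⟨P, hP, rfl⟩
    have h2 : 0 < -r (f (-f P)) := h ⟨-f P, by simpa [hrneg] using h1, rfl⟩
    rw [hfneg, hrneg] at h2
    linarith

/-! ### Positive discriminant -/

omit [E.IsElliptic] in
/-- If the discriminant is positive, the cubic `4x³ + b₂x² + 2b₄x + b₆` has three real roots `e`,
`e + p` and `e + q`, the smallest of which is `e`. -/
lemma exists_three_roots (hΔ : 0 < E.Δ) : ∃ e p q : ℝ, 0 < p ∧ p < q ∧
    ∀ x, 4 * x ^ 3 + E.b₂ * x ^ 2 + 2 * E.b₄ * x + E.b₆ =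
      4 * (x - e) * (x - e - p) * (x - e - q) := by
  obtain ⟨e, a, b, hψ, hD⟩ := E.exists_root
  have hb : b ≠ 0 := by
    rintro rfl
    simp [hD] at hΔ
  have hab : 0 < a ^ 2 - 4 * b := by
    by_contra! h
    have := mul_nonneg (neg_nonneg.mpr h) (sq_nonneg b)
    linarith
  set d := √(a ^ 2 - 4 * b) with hd
  have hd0 : 0 < d := Real.sqrt_pos.mpr hab
  have hd2 : d ^ 2 = a ^ 2 - 4 * b := Real.sq_sqrt hab.le
  obtain ⟨s, hs⟩ : ∃ s, s = (-a - d) / 2 := ⟨_, rfl⟩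
  obtain ⟨t, ht⟩ : ∃ t, t = (-a + d) / 2 := ⟨_, rfl⟩
  have hst : s < t := by linarith
  have hfac : ∀ x, 4 * x ^ 3 + E.b₂ * x ^ 2 + 2 * E.b₄ * x + E.b₆ =
      4 * (x - e) * (x - e - s) * (x - e - t) := by
    intro x
    rw [hψ, hs, ht]
    linear_combination (x - e) * hd2
  have hprod : s * t = b := by
    rw [hs, ht]
    linear_combination -hd2 / 4
  have hs0 : s ≠ 0 := by
    rintro rfl
    simp [eq_comm, hb] at hprod
  have ht0 : t ≠ 0 := by
    rintro rfl
    simp [eq_comm, hb] at hprod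
  rcases lt_or_gt_of_ne hs0 with h | h
  · rcases lt_or_gt_of_ne ht0 with h' | h'
    · exact ⟨e + s, t - s, -s, by linarith, by linarith, fun x => by rw [hfac]; ring⟩
    · exact ⟨e + s, -s, t - s, by linarith, by linarith, fun x => by rw [hfac]; ring⟩
  · exact ⟨e, s, t, h, hst, hfac⟩

/-- The square root of negation. With `u = x - e` and `η = 2y + a₁x + a₃`, it sends `(u, η)` to
`(pq/u, -pqη/u²)` on the bounded component, which is where `u < (p + q)/2`, and to `(pq/u, pqη/u²)`
on the unbounded one; it interchanges the point at infinity and `(e, 0)`. -/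
noncomputable def sqrtNeg {e p q : ℝ}
    (hψ : ∀ x, 4 * x ^ 3 + E.b₂ * x ^ 2 + 2 * E.b₄ * x + E.b₆ =
      4 * (x - e) * (x - e - p) * (x - e - q)) : E.toAffine.Point → E.toAffine.Point
  | .zero => pointOfEta e 0 (by rw [hψ]; ring)
  | .some x y h =>
    if hx : x = e then 0
    else pointOfEta (p * q / (x - e) + e)
      ((if x - e < (p + q) / 2 then -1 else 1) * (p * q) * (2 * y + E.a₁ * x + E.a₃) / (x - e) ^ 2)
      (by
        have h1 := eta_sq h
        have hu : x - e ≠ 0 := sub_ne_zero.mpr hx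
        have hs : ((if x - e < (p + q) / 2 then -1 else 1 : ℝ)) ^ 2 = 1 := by split_ifs <;> norm_num
        rw [hψ] at h1 ⊢
        rw [div_pow, mul_pow, mul_pow, hs, h1]
        field_simp
        ring)

variable {e p q : ℝ}
  (hψ : ∀ x, 4 * x ^ 3 + E.b₂ * x ^ 2 + 2 * E.b₄ * x + E.b₆ =
    4 * (x - e) * (x - e - p) * (x - e - q))

lemma sqrtNeg_zero : sqrtNeg hψ 0 = pointOfEta e 0 (by rw [hψ]; ring) := rfl

lemma sqrtNeg_pointOfEta_self {x η : ℝ} {h} (hx : x = e) : sqrtNeg hψ (pointOfEta x η h) = 0 :=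
  dif_pos hx

lemma exists_sqrtNeg_pointOfEta {x η : ℝ} {h} (hx : x ≠ e) :
    ∃ h', sqrtNeg hψ (pointOfEta x η h) = pointOfEta (p * q / (x - e) + e)
      ((if x - e < (p + q) / 2 then -1 else 1) * (p * q) * η / (x - e) ^ 2) h' := by
  have hη : 2 * ((η - E.a₁ * x - E.a₃) / 2) + E.a₁ * x + E.a₃ = η := by ring
  have h1 : sqrtNeg hψ (pointOfEta x η h) = _ := dif_neg hx
  simp only [hη] at h1
  exact ⟨_, h1⟩

omit [E.IsElliptic] in
include hψ in
/-- The real points lie over `0 ≤ u ≤ p` and `q ≤ u`. -/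
lemma component_cases (hp : 0 < p) (hpq : p < q) {x η : ℝ}
    (h : η ^ 2 = 4 * x ^ 3 + E.b₂ * x ^ 2 + 2 * E.b₄ * x + E.b₆) :
    (0 ≤ x - e ∧ x - e ≤ p) ∨ q ≤ x - e := by
  rw [hψ] at h
  have h0 : 0 ≤ (x - e) * ((x - e - p) * (x - e - q)) := by nlinarith [sq_nonneg η]
  by_contra! hc
  rcases lt_or_ge (x - e) 0 with hu | hu
  · have h1 : 0 < (x - e - p) * (x - e - q) :=
      mul_pos_of_neg_of_neg (by linarith) (by linarith)
    have := mul_neg_of_neg_of_pos hu h1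
    linarith
  · have hup := hc.1 hu
    have h1 : (x - e - p) * (x - e - q) < 0 :=
      mul_neg_of_pos_of_neg (by linarith) (by linarith)
    have := mul_neg_of_pos_of_neg (show 0 < x - e by linarith) h1
    linarith

include hψ in
lemma sqrtNeg_sqrtNeg (hp : 0 < p) (hpq : p < q) (P : E.toAffine.Point) :
    sqrtNeg hψ (sqrtNeg hψ P) = -P := by
  rcases exists_eq_pointOfEta P with rfl | ⟨x, η, h, rfl⟩
  · rw [sqrtNeg_zero, sqrtNeg_pointOfEta_self hψ rfl, neg_zero]
  · rcases eq_or_ne x e with rfl | hx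
    · have hη : η = 0 := by simpa [hψ] using h
      rw [sqrtNeg_pointOfEta_self hψ rfl, sqrtNeg_zero, neg_pointOfEta]
      exact pointOfEta_congr rfl (by simp [hη])
    · have hu : x - e ≠ 0 := sub_ne_zero.mpr hx
      have hq : 0 < q := hp.trans hpq
      have hpq0 : p * q ≠ 0 := by positivity
      have hx' : p * q / (x - e) + e ≠ e := by simpa using ⟨⟨hp.ne', hq.ne'⟩, hu⟩
      obtain ⟨h', h1⟩ := exists_sqrtNeg_pointOfEta hψ (h := h) hx
      rw [h1]
      obtain ⟨h'', h2⟩ := exists_sqrtNeg_pointOfEta hψ (h := h') hx'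
      rw [h2, neg_pointOfEta]
      refine pointOfEta_congr ?_ ?_
      · field_simp
        ring
      · rw [add_sub_cancel_right]
        rcases component_cases hψ hp hpq h with ⟨h0, hup⟩ | hup
        · have hpos : 0 < x - e := lt_of_le_of_ne h0 hu.symm
          have hle : q ≤ p * q / (x - e) := by
            rw [le_div_iff₀ hpos]
            nlinarith
          rw [if_pos (show x - e < (p + q) / 2 by linarith),
            if_neg (show ¬ p * q / (x - e) < (p + q) / 2 by linarith)]
          field_simp
        · have hpos : 0 < x - e := by linarith
          have hle : p * q / (x - e) ≤ p := by
            rw [div_le_iff₀ hpos]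
            nlinarith
          rw [if_neg (show ¬ x - e < (p + q) / 2 by linarith),
            if_pos (show p * q / (x - e) < (p + q) / 2 by linarith)]
          field_simp

variable (E e) in
/-- The vector of the projective coordinates `(x, y, z)` for which `x - ez`, `2y + a₁x + a₃z` and `z`
have given values `u`, `η` and `z`. -/
noncomputable def ofEtaCoords (u η z : ℝ) : Fin 3 → ℝ :=
  ![u + e * z, (η - E.a₁ * (u + e * z) - E.a₃ * z) / 2, z]

omit [E.IsElliptic] in
lemma smul_ofEtaCoords (c u η z : ℝ) :
    c • E.ofEtaCoords e u η z = E.ofEtaCoords e (c * u) (c * η) (c * z) := by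
  ext i
  fin_cases i <;> simp [ofEtaCoords] <;> ring

omit [E.IsElliptic] in
lemma continuous_ofEtaCoords {X : Type*} [TopologicalSpace X] {a b c : X → ℝ} (ha : Continuous a)
    (hb : Continuous b) (hc : Continuous c) :
    Continuous fun x => E.ofEtaCoords e (a x) (b x) (c x) := by
  refine continuous_pi fun i => ?_
  fin_cases i <;> simp [ofEtaCoords] <;> fun_prop

omit [E.IsElliptic] in
lemma ofEtaCoords_ne_zero {u η z : ℝ} (h : u ≠ 0 ∨ η ≠ 0 ∨ z ≠ 0) :
    E.ofEtaCoords e u η z ≠ 0 := by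
  intro h0
  have hz : z = 0 := congrFun h0 2
  have hu : u + e * z = 0 := congrFun h0 0
  have hη : (η - E.a₁ * (u + e * z) - E.a₃ * z) / 2 = 0 := congrFun h0 1
  rw [hu, hz] at hη
  rw [hz] at hu
  rcases h with h | h | h
  · exact h (by linarith)
  · exact h (by linarith)
  · exact h hz

lemma homCoords_pointOfEta_eq {x η : ℝ} {h} :
    homCoords (pointOfEta x η h : E.toAffine.Point) = E.ofEtaCoords e (x - e) η 1 := by
  simp [homCoords_pointOfEta, ofEtaCoords]

omit [E.IsElliptic] in
lemma homCoords_zero_eq : homCoords (0 : E.toAffine.Point) = E.ofEtaCoords e 0 2 0 := by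
  simp [homCoords_zero, ofEtaCoords]

omit [E.IsElliptic] in
/-- A triple of quadratic forms in `u`, `η` and `z` gives a continuous homogeneous map. -/
lemma exists_quadraticMap {A B C : ℝ → ℝ → ℝ → ℝ}
    (hA : Continuous fun w : ℝ × ℝ × ℝ => A w.1 w.2.1 w.2.2)
    (hB : Continuous fun w : ℝ × ℝ × ℝ => B w.1 w.2.1 w.2.2)
    (hC : Continuous fun w : ℝ × ℝ × ℝ => C w.1 w.2.1 w.2.2)
    (hA' : ∀ c u η z, A (c * u) (c * η) (c * z) = c ^ 2 * A u η z)
    (hB' : ∀ c u η z, B (c * u) (c * η) (c * z) = c ^ 2 * B u η z)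
    (hC' : ∀ c u η z, C (c * u) (c * η) (c * z) = c ^ 2 * C u η z) :
    ∃ F : (Fin 3 → ℝ) → (Fin 3 → ℝ), Continuous F ∧ (∀ (c : ℝ) v, F (c • v) = c ^ 2 • F v) ∧
      ∀ u η z, F (E.ofEtaCoords e u η z) = E.ofEtaCoords e (A u η z) (B u η z) (C u η z) := by
  let T : (Fin 3 → ℝ) → ℝ × ℝ × ℝ := fun v => (v 0 - e * v 2, E.etaForm v, v 2)
  have hT : Continuous T := by
    have := E.continuous_etaForm
    fun_prop
  have hA1 := hA.comp hT
  have hB1 := hB.comp hT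
  have hC1 := hC.comp hT
  refine ⟨fun v => E.ofEtaCoords e (A (v 0 - e * v 2) (E.etaForm v) (v 2))
    (B (v 0 - e * v 2) (E.etaForm v) (v 2)) (C (v 0 - e * v 2) (E.etaForm v) (v 2)), ?_, ?_, ?_⟩
  · exact continuous_ofEtaCoords hA1 hB1 hC1
  · intro c v
    have h0 : c * v 0 - e * (c * v 2) = c * (v 0 - e * v 2) := by ring
    simp only [Pi.smul_apply, smul_eq_mul, etaForm_smul, h0, hA', hB', hC', smul_ofEtaCoords]
  · intro u η z
    have h1 : E.etaForm (E.ofEtaCoords e u η z) = η := by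
      simp [etaForm, ofEtaCoords]
      ring
    simp only [h1]
    simp [ofEtaCoords]

/-- A point over `u = x - e` on the given side of `(p + q)/2` has a neighbourhood of affine points
on the same side. -/
lemma eventually_side {m σ x η : ℝ} {h} (hx : 0 < σ * (m - (x - e))) :
    ∀ᶠ Q in 𝓝 (pointOfEta x η h : E.toAffine.Point),
      ∃ x' η' h', Q = pointOfEta x' η' h' ∧ 0 < σ * (m - (x' - e)) := by
  have hev := eventually_pos (E := E) (P := pointOfEta x η h)
    (r := fun v => σ * (m * v 2 ^ 2 - (v 0 - e * v 2) * v 2)) (by fun_prop)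
    (fun c v => by simp only [Pi.smul_apply, smul_eq_mul]; ring)
    (by simpa [homCoords_pointOfEta] using hx)
  filter_upwards [hev] with Q hQ
  rcases exists_eq_pointOfEta Q with rfl | ⟨x', η', h', rfl⟩
  · simp [homCoords_zero] at hQ
  · exact ⟨x', η', h', rfl, by simpa [homCoords_pointOfEta] using hQ⟩

include hψ in
/-- Affine points near infinity lie on the unbounded component: on the bounded one, `η²` is bounded. -/
lemma eventually_zero (hp : 0 < p) (hpq : p < q) :
    ∀ᶠ Q in 𝓝 (0 : E.toAffine.Point), Q = 0 ∨ ∃ x η h, Q = pointOfEta x η h ∧ q ≤ x - e := by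
  have hev := eventually_pos (E := E) (P := 0)
    (r := fun v => E.etaForm v ^ 2 - 4 * p * (p * q) * v 2 ^ 2)
    (by have := E.continuous_etaForm; fun_prop)
    (fun c v => by simp only [etaForm_smul, Pi.smul_apply, smul_eq_mul]; ring)
    (by simp [homCoords_zero, etaForm])
  filter_upwards [hev] with Q hQ
  rcases exists_eq_pointOfEta Q with rfl | ⟨x, η, h, rfl⟩
  · exact .inl rfl
  · refine .inr ⟨x, η, h, rfl, ?_⟩
    rcases component_cases hψ hp hpq h with ⟨h0, hup⟩ | hup
    · rw [etaForm_pointOfEta] at hQ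
      have hQ' : 4 * p * (p * q) < η ^ 2 := by simpa [homCoords_pointOfEta] using hQ
      rw [h, hψ] at hQ'
      have h1 : (p - (x - e)) * (q - (x - e)) ≤ p * q :=
        mul_le_mul (by linarith) (by linarith) (by linarith) hp.le
      have h2 : (x - e) * ((p - (x - e)) * (q - (x - e))) ≤ p * (p * q) :=
        mul_le_mul hup h1 (mul_nonneg (by linarith) (by linarith)) hp.le
      linarith
    · exact hup

/-- Continuity at affine points other than `(e, 0)`, where the coordinates of the image are
`(pquz, ±pqηz, u²)`. -/
lemma continuousAt_sqrtNeg_of_ne (hp : 0 < p) (hpq : p < q) {x η : ℝ} {h} (hx : x ≠ e) :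
    ContinuousAt (sqrtNeg hψ) (pointOfEta x η h) := by
  have hu : x - e ≠ 0 := sub_ne_zero.mpr hx
  have hside : ∀ {x η : ℝ}, η ^ 2 = 4 * x ^ 3 + E.b₂ * x ^ 2 + 2 * E.b₄ * x + E.b₆ →
      x - e < (p + q) / 2 ∨ (p + q) / 2 < x - e := by
    intro x η h
    rcases component_cases hψ hp hpq h with ⟨h0, hup⟩ | hup
    · exact .inl (by linarith)
    · exact .inr (by linarith)
  obtain ⟨σ, hσ⟩ : ∃ σ : ℝ, σ = if x - e < (p + q) / 2 then -1 else 1 := ⟨_, rfl⟩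
  have hσx : 0 < -σ * ((p + q) / 2 - (x - e)) := by
    rw [hσ]
    rcases hside h with h1 | h1
    · rw [if_pos h1]; linarith
    · rw [if_neg h1.not_gt]; linarith
  have hσ1 : σ = -1 ∨ σ = 1 := by rw [hσ]; split_ifs <;> simp
  obtain ⟨F, hF, hom, hFv⟩ := exists_quadraticMap (E := E) (e := e)
    (A := fun u _ z => p * q * (u * z)) (B := fun _ η z => σ * (p * q) * (η * z))
    (C := fun u _ _ => u ^ 2) (by fun_prop) (by fun_prop) (by fun_prop)
    (by intros; ring) (by intros; ring) (by intros; ring)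
  refine continuousAt_of_homogeneous hF hom ?_ ?_
  · rw [homCoords_pointOfEta_eq (e := e), hFv]
    exact ofEtaCoords_ne_zero (.inr (.inr (pow_ne_zero 2 hu)))
  · filter_upwards [eventually_side hσx] with Q hQ
    obtain ⟨x', η', h', rfl, hσx'⟩ := hQ
    rw [homCoords_pointOfEta_eq (e := e), hFv]
    refine ⟨(x' - e) ^ 2, ?_⟩
    have hσ' : (if x' - e < (p + q) / 2 then -1 else 1) = σ := by
      rcases hσ1 with rfl | rfl
      · exact if_pos (by linarith)
      · exact if_neg (by linarith)
    rcases eq_or_ne x' e with rfl | hx'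
    · have hη : η' = 0 := by simpa [hψ] using h'
      simp [hη, ofEtaCoords]
    · have hu' : x' - e ≠ 0 := sub_ne_zero.mpr hx'
      obtain ⟨h'', h1⟩ := exists_sqrtNeg_pointOfEta hψ (h := h') hx'
      rw [h1, homCoords_pointOfEta_eq (e := e), smul_ofEtaCoords, hσ']
      congr 1 <;> field_simp
      ring

/-- Continuity at `(e, 0)`. Multiplying the coordinates `(pquz, -pqηz, u²)` of the image by `η/u` and
using the equation of the curve gives `(pqηz, -4pq(u - pz)(u - qz), uη)`. -/
lemma continuousAt_sqrtNeg_self (hp : 0 < p) (hpq : p < q) {η : ℝ} {h} :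
    ContinuousAt (sqrtNeg hψ) (pointOfEta e η h) := by
  have hq : 0 < q := hp.trans hpq
  obtain ⟨F, hF, hom, hFv⟩ := exists_quadraticMap (E := E) (e := e)
    (A := fun _ η z => p * q * (η * z))
    (B := fun u _ z => -(4 * (p * q) * ((u - p * z) * (u - q * z))))
    (C := fun u η _ => u * η) (by fun_prop) (by fun_prop) (by fun_prop)
    (by intros; ring) (by intros; ring) (by intros; ring)
  have hη0 : ∀ {η : ℝ}, η ^ 2 = 4 * e ^ 3 + E.b₂ * e ^ 2 + 2 * E.b₄ * e + E.b₆ → η = 0 := by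
    intro η h
    simpa [hψ] using h
  refine continuousAt_of_homogeneous hF hom ?_ ?_
  · rw [homCoords_pointOfEta_eq (e := e), hFv]
    refine ofEtaCoords_ne_zero (.inr (.inl ?_))
    simp [hp.ne', hq.ne']
  · filter_upwards [eventually_side (e := e) (σ := 1) (m := (p + q) / 2) (by linarith)] with Q hQ
    obtain ⟨x', η', h', rfl, hx'm⟩ := hQ
    rw [homCoords_pointOfEta_eq (e := e), hFv]
    rcases eq_or_ne x' e with rfl | hx'
    · refine ⟨-2 * (p * q) ^ 2, ?_⟩
      rw [sqrtNeg_pointOfEta_self hψ rfl, homCoords_zero_eq (e := x'), smul_ofEtaCoords, hη0 h']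
      congr 1 <;> ring
    · refine ⟨(x' - e) * η', ?_⟩
      have hu' : x' - e ≠ 0 := sub_ne_zero.mpr hx'
      obtain ⟨h'', h1⟩ := exists_sqrtNeg_pointOfEta hψ (h := h') hx'
      rw [h1, homCoords_pointOfEta_eq (e := e), smul_ofEtaCoords, if_pos (by linarith)]
      rw [hψ] at h'
      congr 1
      · field_simp
        ring
      · field_simp
        linear_combination h'
      · ring

/-- Continuity at infinity. Multiplying the coordinates `(pquz, pqηz, u²)` of the image by `4u/z` and
using the equation of the curve gives `(4pqu², 4pquη, η² + 4(p + q)u² - 4pquz)`. -/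
lemma continuousAt_sqrtNeg_zero (hp : 0 < p) (hpq : p < q) : ContinuousAt (sqrtNeg hψ) 0 := by
  obtain ⟨F, hF, hom, hFv⟩ := exists_quadraticMap (E := E) (e := e)
    (A := fun u _ _ => 4 * (p * q) * u ^ 2) (B := fun u η _ => 4 * (p * q) * (u * η))
    (C := fun u η z => η ^ 2 + 4 * (p + q) * u ^ 2 - 4 * (p * q) * (u * z))
    (by fun_prop) (by fun_prop) (by fun_prop)
    (by intros; ring) (by intros; ring) (by intros; ring)
  refine continuousAt_of_homogeneous hF hom ?_ ?_
  · rw [homCoords_zero_eq (e := e), hFv]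
    exact ofEtaCoords_ne_zero (.inr (.inr (by norm_num)))
  · filter_upwards [eventually_zero hψ hp hpq] with Q hQ
    rcases hQ with rfl | ⟨x, η, h, rfl, hx⟩
    · refine ⟨4, ?_⟩
      rw [sqrtNeg_zero, homCoords_zero_eq (e := e), hFv, homCoords_pointOfEta_eq (e := e),
        smul_ofEtaCoords]
      congr 1 <;> ring
    · refine ⟨4 * (x - e) ^ 3, ?_⟩
      have hu : x - e ≠ 0 := by
        intro h0
        linarith
      obtain ⟨h', h1⟩ := exists_sqrtNeg_pointOfEta hψ (h := h) (sub_ne_zero.mp hu)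
      rw [homCoords_pointOfEta_eq (e := e), hFv, h1, homCoords_pointOfEta_eq (e := e),
        smul_ofEtaCoords, if_neg (by linarith)]
      rw [hψ] at h
      congr 1
      · field_simp
        ring
      · field_simp
      · linear_combination h

omit hψ in
lemma exists_sqrt_neg (hΔ : 0 < E.Δ) : ∃ f : E.toAffine.Point → E.toAffine.Point,
    Continuous f ∧ ∀ P, f (f P) = -P := by
  obtain ⟨e, p, q, hp, hpq, hψ⟩ := exists_three_roots hΔ
  refine ⟨sqrtNeg hψ, continuous_iff_continuousAt.mpr fun P => ?_, sqrtNeg_sqrtNeg hψ hp hpq⟩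
  rcases exists_eq_pointOfEta P with rfl | ⟨x, η, h, rfl⟩
  · exact continuousAt_sqrtNeg_zero hψ hp hpq
  · rcases eq_or_ne x e with rfl | hx
    · exact continuousAt_sqrtNeg_self hψ hp hpq
    · exact continuousAt_sqrtNeg_of_ne hψ hp hpq hx

end WeierstrassCurve

theorem mainTheorem5 (E : WeierstrassCurve ℝ) [E.IsElliptic] :
    (∃ f : E.toAffine.Point ≃ E.toAffine.Point, Continuous f ∧ IsInverseAmbiguous f) ↔
      0 < E.Δ := by
  constructor
  · rintro ⟨f, hf, hfi⟩
    by_contra hΔ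
    refine WeierstrassCurve.not_exists_sqrt_neg
      (lt_of_le_of_ne (not_lt.mp hΔ) E.isUnit_Δ.ne_zero) hf fun P => ?_
    have h := hfi (f P)
    rw [Equiv.symm_apply_apply] at h
    exact (neg_eq_iff_eq_neg.mpr h).symm
  · intro hΔ
    obtain ⟨f, hf, hff⟩ := WeierstrassCurve.exists_sqrt_neg hΔ
    have hfneg : ∀ P, f (-P) = -f P := fun P => by rw [← hff P, hff]
    exact ⟨⟨f, fun P => -f P, fun P => neg_eq_iff_eq_neg.mpr (hff P),
      fun P => by rw [hfneg, hff, neg_neg]⟩, hf, fun P => rfl⟩
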